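/- Let $E$ be a measurable space, $\theta>0$, $\nu$ a probability measure on $E$, and $R$ a transition kernel on $E$ with $R_x(E)<\infty$ for all $x$. A sequence $(X_n)_{n\ge1}$ of $E$-valued random variables is called a measure-valued P\'olya sequence, MVPS$(\theta,\nu,R)$, if $X_1\sim\nu$ and, for every $n\ge1$, \[\mathbb{P}(X_{n+1}\in\cdot\mid X_1,\dots,X_n)=\frac{\theta\nu(\cdot)+\sum_{i=1}^nR_{X_i}(\cdot)}{\theta+\sum_{i=1}^nR_{X_i}(E)};\] it is a (Blackwell--MacQueen) P\'olya sequence with parameters $(\theta,\nu)$ if $R_x=\delta_x$. Let $(\mathbb{X},\mathcal{X})$ be a standard Borel space and $\nu$ a probability measure on it. For a sub-$\sigma$-algebra $\mathcal{G}\subseteq\mathcal{X}$, let $[x]_{\mathcal{G}}=\bigcap_{G\in\mathcal{G},\,x\in G}G$ be its atom at $x$, let $\Pi=\{[x]_{\mathcal{G}}:x\in\mathbb{X}\}$ and $\pi:\mathbb{X}\to\Pi$, $\pi(x)=[x]_{\mathcal{G}}$, and equip $\Pi$ with the $\sigma$-algebra $\{S\subseteq\Pi:\pi^{-1}(S)\in\mathcal{G}\}$.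 Call $\mathcal{G}$ countably generated under $\nu$ if there is $C\in\mathcal{G}$ with $\nu(C)=1$ such that the trace $\mathcal{G}\cap C$ is countably generated. Let $(X_n)_{n\ge1}$ be an exchangeable MVPS$(\theta,\nu,R)$ with values in $\mathbb{X}$. Put $Z=\{x:R_x(\mathbb{X})=0\}$, and suppose that the parametrization is canonical, i.e. $R_x(\mathbb{X})=1$ for all $x\notin Z$, and that the reinforcement is strictly positive, i.e. $\nu(Z)=0$. Then there exists a sub-$\sigma$-algebra $\mathcal{G}\subseteq\mathcal{X}$, countably generated under $\nu$, such that \[\frac{R_x(\cdot)}{R_x(\mathbb{X})}=\nu(\cdot\mid\mathcal{G})(x)\qquad\text{for $\nu$-a.e. }x,\] where $\nu(\cdot\mid\mathcal{G})$ is the regular conditional distribution of $\nu$ given $\mathcal{G}$. Moreover, for every such $\mathcal{G}$, with $\pi$ the associated map to atoms, the sequence $(\pi(X_n))_{n\ge1}$ is a P\'olya sequence with parameters $(\theta,\nu\circ\pi^{-1})$. -/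

import Mathlib

open MeasureTheory ProbabilityTheory

namespace MVPS

section Sequences

variable {Ω E : Type*} [MeasurableSpace Ω] [MeasurableSpace E]

/-- A sequence `X 0, X 1, …` of random variables is exchangeable under `P`: the joint law of the
first `n` of them is invariant under all permutations, for every `n`. -/
def Exchangeable (P : Measure Ω) (X : ℕ → Ω → E) : Prop :=
  ∀ (n : ℕ) (σ : Equiv.Perm (Fin n)),
    P.map (fun ω (i : Fin n) => X (σ i) ω) = P.map (fun ω (i : Fin n) => X i ω)

/-- The sub-σ-algebra of `Ω` generated by the first `n` observations `X 0, …, X (n - 1)`. -/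
@[reducible] def pastSigma (X : ℕ → Ω → E) (n : ℕ) : MeasurableSpace Ω :=
  MeasurableSpace.comap (fun ω (i : Fin n) => X i ω) inferInstance

/-- `X` is a measure-valued Pólya sequence with parameters `θ`, `ν`, `R` under `P`. The sequence is
indexed from `0`, so that `X n` is the `(n+1)`-st observation. The reinforcement kernel `R` is
finite in the sense that every `R x` is a finite measure (no uniform bound is required).
The predictive distribution of `X n` given `X 0, …, X (n - 1)` is
`(θ ν + ∑ i < n, R (X i)) / (θ + ∑ i < n, R (X i) E)`, that is, the value of this random
probability measure at each measurable set `A` is a version of the conditional probability of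
`{X n ∈ A}`. -/
structure IsMVPS (P : Measure Ω) (θ : ℝ) (ν : Measure E) (R : Kernel E E) (X : ℕ → Ω → E) :
    Prop where
  theta_pos : 0 < θ
  prob : IsProbabilityMeasure ν
  finite : ∀ x, IsFiniteMeasure (R x)
  measurable : ∀ n, Measurable (X n)
  law_zero : P.map (X 0) = ν
  predictive : ∀ n, 1 ≤ n → ∀ A : Set E, MeasurableSet A →
    P⟦X n ⁻¹' A | pastSigma X n⟧ =ᵐ[P] fun ω =>
      (θ * ν.real A + ∑ i ∈ Finset.range n, (R (X i ω)).real A) /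
        (θ + ∑ i ∈ Finset.range n, (R (X i ω)).real Set.univ)

/-- A Blackwell–MacQueen Pólya sequence with parameters `θ`, `ν`: a measure-valued Pólya sequence
whose reinforcement at `x` is the unit mass at `x` (`Kernel.id x = Measure.dirac x`). -/
def IsPolyaSequence (P : Measure Ω) (θ : ℝ) (ν : Measure E) (X : ℕ → Ω → E) : Prop :=
  IsMVPS P θ ν Kernel.id X

/-- The set `Z` of points at which the reinforcement vanishes. -/
def nullSet (R : Kernel E E) : Set E := {x | R x Set.univ = 0}

/-- The reinforcement is strictly positive: `ν Z = 0`. -/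
def StrictlyPositive (ν : Measure E) (R : Kernel E E) : Prop := ν (nullSet R) = 0

/-- The parametrization is canonical: `R x` has total mass one for every `x` outside `Z`. -/
def Canonical (R : Kernel E E) : Prop := ∀ x, x ∉ nullSet R → R x Set.univ = 1

end Sequences

section Atoms

variable {E : Type*}

/-- The set `Π` of all atoms `[x] = ⋂ {G ∈ 𝒢, x ∈ G} G` of the σ-algebra `𝒢`. -/
def AtomSpace (𝒢 : MeasurableSpace E) : Type _ := Set.range (@measurableAtom E 𝒢)

/-- The map `π` that sends a point to its `𝒢`-atom. -/
def atomMap (𝒢 : MeasurableSpace E) (x : E) : AtomSpace 𝒢 :=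
  ⟨@measurableAtom E 𝒢 x, Set.mem_range_self x⟩

/-- The σ-algebra `{S ⊆ Π : π⁻¹ S ∈ 𝒢}` on the set of atoms. -/
instance (𝒢 : MeasurableSpace E) : MeasurableSpace (AtomSpace 𝒢) :=
  MeasurableSpace.map (atomMap 𝒢) 𝒢

theorem measurableSet_atomSpace_iff (𝒢 : MeasurableSpace E) (S : Set (AtomSpace 𝒢)) :
    MeasurableSet S ↔ MeasurableSet[𝒢] (atomMap 𝒢 ⁻¹' S) := Iff.rfl

theorem measurable_atomMap {𝒢 mE : MeasurableSpace E} (h : 𝒢 ≤ mE) :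
    Measurable[mE] (atomMap 𝒢) := fun _ hS => h _ hS

/-- The image `ν ∘ π⁻¹` on the set of atoms of a measure `ν` on `E`. -/
noncomputable def atomMeasure {mE : MeasurableSpace E} (ν : Measure E) (𝒢 : MeasurableSpace E) :
    Measure (AtomSpace 𝒢) := @Measure.map E (AtomSpace 𝒢) mE _ (atomMap 𝒢) ν

end Atoms

section Conditioning

variable {E : Type*} {mE : MeasurableSpace E}

/-- `𝒢` is countably generated under `ν`: for some `C ∈ 𝒢` with `ν C = 1`, the trace of `𝒢`
on `C` is countably generated. -/
def CountablyGeneratedUnder (ν : Measure E) (𝒢 : MeasurableSpace E) : Prop :=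
  ∃ C : Set E, MeasurableSet[𝒢] C ∧ ν C = 1 ∧
    @MeasurableSpace.CountablyGenerated C (𝒢.comap Subtype.val)

/-- `𝒢` is a conditioning σ-algebra for the reinforcement kernel `R`: a sub-σ-algebra, countably
generated under `ν`, such that the normalized reinforcement `R x / R x E` is, for `ν`-a.e. `x`,
the regular conditional distribution `ν(· | 𝒢)(x)`. -/
structure IsConditioning [StandardBorelSpace E] (ν : Measure E) [IsFiniteMeasure ν]
    (R : Kernel E E) (𝒢 : MeasurableSpace E) : Prop where
  le : 𝒢 ≤ mE
  countablyGenerated : CountablyGeneratedUnder ν 𝒢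
  ae_eq : ∀ᵐ x ∂ν, (R x Set.univ)⁻¹ • R x = condExpKernel (mΩ := mE) ν 𝒢 x

end Conditioning

end MVPS

/-!
Exchangeability gives `X 1` the law `ν` and makes the pairs `(X 0, X 1)` and `(X 0, X 2)` equal in
law. Read through the predictive distributions, the first fact says that `ν` is invariant under
`R`, and the second that `R` is idempotent `ν`-almost everywhere: both appear as terms left over
when equal measures are cancelled. Take `x` with law `ν` and `y` with law `R x`. For bounded `h`
with `∫ h dR x = h x`, invariance of `ν` makes the mean of `(h x - h y) ^ 2` vanish; by idempotence
this applies to `h x = R x A`, so `R x = R y` almost surely. Hence `R` is the conditional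
distribution of `ν` given the σ-algebra that `R` itself generates.

If `R` is the conditional distribution given `𝒢`, it gives mass `0` or `1` to each set of `𝒢`,
so that on the atoms it becomes `x ↦ δ_x`. The predictive probabilities of the events of `π (X n)`
are then functions of the past of `π ∘ X` alone, and the tower property allows conditioning on that
smaller past.
-/

namespace MVPS

theorem exists_countable_isPiSystem_generateFrom {E : Type*} {mE : MeasurableSpace E}
    [h : MeasurableSpace.CountablyGenerated E] :
    ∃ S : Set (Set E), S.Countable ∧ IsPiSystem S ∧ mE = MeasurableSpace.generateFrom S := by
  obtain ⟨b, hb, rfl⟩ := h.isCountablyGenerated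
  exact ⟨generateSetAlgebra b, countable_generateSetAlgebra hb,
    fun s hs t ht _ => isSetAlgebra_generateSetAlgebra.inter_mem hs ht,
    generateFrom_generateSetAlgebra_eq.symm⟩

section KernelSigma

variable {E F : Type*} {mE : MeasurableSpace E} {mF : MeasurableSpace F} {μ : Measure E}
  {κ : Kernel E F}

/-- The σ-algebra generated by a kernel `κ`, seen as a random measure `x ↦ κ x`: the smallest one
for which every evaluation `x ↦ κ x A` is measurable. -/
@[reducible] def kernelSigma (κ : Kernel E F) : MeasurableSpace E :=
  MeasurableSpace.comap κ inferInstance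

theorem kernelSigma_le : kernelSigma κ ≤ mE := κ.measurable.comap_le

theorem countablyGenerated_kernelSigma [MeasurableSpace.CountablyGenerated F] [IsMarkovKernel κ] :
    @MeasurableSpace.CountablyGenerated E (kernelSigma κ) := by
  obtain ⟨S, hS, hpi, hgen⟩ := exists_countable_isPiSystem_generateFrom (mE := mF)
  have hSm : ∀ A ∈ S, MeasurableSet A := fun A hA =>
    hgen ▸ MeasurableSpace.measurableSet_generateFrom hA
  have := hS.to_subtype
  let Φ : E → S → ENNReal := fun x A => κ x A
  suffices h : kernelSigma κ = MeasurableSpace.comap Φ inferInstance from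
    h ▸ MeasurableSpace.CountablyGenerated.comap Φ
  apply le_antisymm
  · refine Measurable.comap_le (m₁ := MeasurableSpace.comap Φ inferInstance) ?_
    refine Measurable.measure_of_isPiSystem_of_isProbabilityMeasure hgen hpi fun A hA => ?_
    exact (measurable_pi_apply (⟨A, hA⟩ : S)).comp (comap_measurable Φ)
  · exact (@measurable_pi_lambda E S _ (kernelSigma κ) _ Φ fun A =>
      (Measure.measurable_coe (hSm A A.2)).comp (comap_measurable κ)).comap_le

theorem countablyGeneratedUnder_kernelSigma [MeasurableSpace.CountablyGenerated F]
    [IsProbabilityMeasure μ] [IsMarkovKernel κ] : CountablyGeneratedUnder μ (kernelSigma κ) :=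
  ⟨Set.univ, MeasurableSet.univ, measure_univ,
    @MeasurableSpace.CountablyGenerated.comap _ _ (kernelSigma κ) countablyGenerated_kernelSigma _⟩

end KernelSigma

section InvariantKernel

variable {E : Type*} {mE : MeasurableSpace E} {μ : Measure E} {κ : Kernel E E}

theorem measurePreserving_fst_compProd {F : Type*} [MeasurableSpace F] [SFinite μ]
    (κ : Kernel E F) [IsMarkovKernel κ] : MeasurePreserving Prod.fst (μ ⊗ₘ κ) μ :=
  ⟨measurable_fst, Measure.fst_compProd μ κ⟩

theorem measurePreserving_snd_compProd [SFinite μ] [IsSFiniteKernel κ]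
    (hκ : Kernel.Invariant κ μ) : MeasurePreserving Prod.snd (μ ⊗ₘ κ) μ :=
  ⟨measurable_snd, (Measure.snd_compProd μ κ).trans hκ⟩

theorem ae_compProd_eq_of_integral_eq [SFinite μ] [IsMarkovKernel κ]
    (hκ : Kernel.Invariant κ μ) {h : E → ℝ} (hh : MemLp h 2 μ)
    (hharm : ∀ᵐ x ∂μ, ∫ y, h y ∂κ x = h x) : ∀ᵐ p ∂(μ ⊗ₘ κ), h p.1 = h p.2 := by
  have hfst := measurePreserving_fst_compProd (μ := μ) κ
  have hsnd := measurePreserving_snd_compProd hκ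
  have hh₁ : MemLp (fun p : E × E => h p.1) 2 (μ ⊗ₘ κ) := hh.comp_measurePreserving hfst
  have hh₂ : MemLp (fun p : E × E => h p.2) 2 (μ ⊗ₘ κ) := hh.comp_measurePreserving hsnd
  have hint : Integrable (fun p : E × E => h p.1 * h p.2) (μ ⊗ₘ κ) := hh₁.integrable_mul hh₂
  have hsq {f : E × E → E} (hf : MeasurePreserving f (μ ⊗ₘ κ) μ) :
      ∫ p, h (f p) ^ 2 ∂(μ ⊗ₘ κ) = ∫ x, h x ^ 2 ∂μ := by
    conv_rhs => rw [← hf.map_eq]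
    rw [integral_map hf.aemeasurable (by rw [hf.map_eq]; exact hh.1.pow 2)]
  have hmul : ∫ p, h p.1 * h p.2 ∂(μ ⊗ₘ κ) = ∫ x, h x ^ 2 ∂μ := by
    rw [Measure.integral_compProd hint]
    refine integral_congr_ae ?_
    filter_upwards [hharm] with x hx
    rw [integral_const_mul, hx, sq]
  have hzero : ∫ p, (h p.1 - h p.2) ^ 2 ∂(μ ⊗ₘ κ) = 0 := by
    simp only [sub_sq, mul_assoc]
    have hsub : Integrable (fun p : E × E => h p.1 ^ 2 - 2 * (h p.1 * h p.2)) (μ ⊗ₘ κ) :=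
      hh₁.integrable_sq.sub (hint.const_mul 2)
    rw [integral_add hsub hh₂.integrable_sq,
      integral_sub hh₁.integrable_sq (hint.const_mul 2), integral_const_mul, hsq hfst, hsq hsnd,
      hmul]
    ring
  filter_upwards [(integral_eq_zero_iff_of_nonneg (fun _ => sq_nonneg _)
    (hh₁.sub hh₂).integrable_sq).1 hzero] with p hp
  exact sub_eq_zero.1 (sq_eq_zero_iff.1 hp)

theorem integral_measureReal_eq_measureReal_comp {F G : Type*} {mF : MeasurableSpace F}
    {mG : MeasurableSpace G} (η : Kernel F G) [IsFiniteKernel η] (κ : Kernel E F) {A : Set G}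
    (hA : MeasurableSet A) (x : E) : ∫ y, (η y).real A ∂κ x = ((η ∘ₖ κ) x).real A := by
  rw [measureReal_def, Kernel.comp_apply' _ _ _ hA]
  exact integral_toReal (η.measurable_coe hA).aemeasurable (ae_of_all _ fun y => measure_lt_top _ _)

theorem ae_compProd_eq_of_idempotent [MeasurableSpace.CountablyGenerated E] [IsFiniteMeasure μ]
    [IsMarkovKernel κ] (hκ : Kernel.Invariant κ μ) (hidem : κ ∘ₖ κ =ᵐ[μ] κ) :
    ∀ᵐ p ∂(μ ⊗ₘ κ), κ p.1 = κ p.2 := by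
  obtain ⟨S, hS, hpi, hgen⟩ := exists_countable_isPiSystem_generateFrom (mE := mE)
  have hreal : ∀ A ∈ S, ∀ᵐ p ∂(μ ⊗ₘ κ), (κ p.1).real A = (κ p.2).real A := fun A hAS => by
    have hA : MeasurableSet A := hgen ▸ MeasurableSpace.measurableSet_generateFrom hAS
    refine ae_compProd_eq_of_integral_eq (h := fun x => (κ x).real A) hκ
      (.of_bound (κ.measurable_coe hA).ennreal_toReal.aestronglyMeasurable 1
        (ae_of_all _ fun x => ?_)) ?_
    · rw [Real.norm_of_nonneg measureReal_nonneg]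
      exact measureReal_le_one
    · filter_upwards [hidem] with x hx
      rw [integral_measureReal_eq_measureReal_comp κ κ hA, hx]
  filter_upwards [(ae_ball_iff hS).2 hreal] with p hp
  refine ext_of_generate_finite S hgen hpi (fun A hA => ?_) (by simp)
  exact (measureReal_eq_measureReal_iff).1 (hp A hA)

theorem compProd_prod_eq_measure_inter [MeasurableSpace.CountablyGenerated E] [IsFiniteMeasure μ]
    [IsMarkovKernel κ] (hκ : Kernel.Invariant κ μ) (hidem : κ ∘ₖ κ =ᵐ[μ] κ)
    {A B : Set E} (hA : MeasurableSet A) (hB : MeasurableSet[kernelSigma κ] B) :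
    (μ ⊗ₘ κ) (B ×ˢ A) = μ (B ∩ A) := by
  have hBA : MeasurableSet (B ∩ A) := (kernelSigma_le _ hB).inter hA
  rw [← (measurePreserving_snd_compProd hκ).measure_preimage hBA.nullMeasurableSet]
  refine measure_congr ?_
  obtain ⟨T, -, rfl⟩ := hB
  filter_upwards [ae_compProd_eq_of_idempotent hκ hidem] with p hp
  refine propext ?_
  change (κ p.1 ∈ T ∧ p.2 ∈ A) ↔ (κ p.2 ∈ T ∧ p.2 ∈ A)
  rw [hp]

theorem ae_eq_condExpKernel_of_setLIntegral_eq {E : Type*} {m mE : MeasurableSpace E}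
    [StandardBorelSpace E] {μ : Measure E} [IsFiniteMeasure μ] (hm : m ≤ mE)
    {η : Kernel[m, mE] E E} [IsFiniteKernel η]
    (hη : ∀ A B, MeasurableSet A → MeasurableSet[m] B → ∫⁻ x in B, η x A ∂μ = μ (B ∩ A)) :
    ∀ᵐ x ∂μ, η x = condExpKernel μ m x := by
  refine ae_eq_of_ae_eq_trim (hm := hm) (Kernel.ae_eq_of_compProd_eq ?_)
  rw [compProd_trim_condExpKernel hm]
  have : IsFiniteMeasure (μ.trim hm) := isFiniteMeasure_trim hm
  refine Measure.ext_prod fun {B A} hB hA => ?_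
  have hBA := hB.prod hA
  have hdiag : @Measurable E (E × E) mE (m.prod mE) Function.diag :=
    (measurable_id'' hm).prodMk measurable_id
  rw [Measure.compProd_apply_prod hB hA, Measure.map_apply hdiag hBA,
    restrict_trim hm _ hB, lintegral_trim hm (η.measurable_coe hA), hη A B hA hB]
  rfl

theorem isConditioning_kernelSigma [StandardBorelSpace E] [IsProbabilityMeasure μ]
    [IsMarkovKernel κ] (hκ : Kernel.Invariant κ μ) (hidem : κ ∘ₖ κ =ᵐ[μ] κ) {R : Kernel E E}
    (hR : R =ᵐ[μ] κ) : IsConditioning μ R (kernelSigma κ) where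
  le := kernelSigma_le
  countablyGenerated := countablyGeneratedUnder_kernelSigma
  ae_eq := by
    let η := @Kernel.mk E E (kernelSigma κ) mE κ (comap_measurable κ)
    have : IsFiniteKernel η := ⟨1, ENNReal.one_lt_top, fun x => (measure_univ (μ := κ x)).le⟩
    have hη : ∀ᵐ x ∂μ, η x = condExpKernel (mΩ := mE) μ (kernelSigma κ) x :=
      ae_eq_condExpKernel_of_setLIntegral_eq kernelSigma_le fun A B hA hB => by
        rw [← compProd_prod_eq_measure_inter hκ hidem hA hB,
          Measure.compProd_apply_prod (kernelSigma_le _ hB) hA]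
        rfl
    filter_upwards [hR, hη] with x hRx hηx
    rw [hRx, measure_univ, inv_one, one_smul, ← hηx]
    rfl

end InvariantKernel

section Exchangeability

variable {Ω E : Type*} [MeasurableSpace Ω] [MeasurableSpace E] {P : Measure Ω} {X : ℕ → Ω → E}

theorem Exchangeable.map_comp {F : Type*} [MeasurableSpace F] (hX : Exchangeable P X)
    (hm : ∀ n, Measurable (X n)) {n : ℕ} (σ : Equiv.Perm (Fin n)) {g : (Fin n → E) → F}
    (hg : Measurable g) :
    P.map (fun ω => g fun i => X (σ i) ω) = P.map (fun ω => g fun i => X i ω) := by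
  have h := congrArg (Measure.map g) (hX n σ)
  rwa [Measure.map_map hg (measurable_pi_lambda _ fun i => hm _),
    Measure.map_map hg (measurable_pi_lambda _ fun i => hm _)] at h

theorem Exchangeable.map_one (hX : Exchangeable P X) (hm : ∀ n, Measurable (X n)) :
    P.map (X 1) = P.map (X 0) := by
  simpa using hX.map_comp hm (Equiv.swap (0 : Fin 2) 1) (measurable_pi_apply 0)

theorem Exchangeable.map_zero_two (hX : Exchangeable P X) (hm : ∀ n, Measurable (X n)) :
    P.map (fun ω => (X 0 ω, X 2 ω)) = P.map (fun ω => (X 0 ω, X 1 ω)) := by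
  have h := hX.map_comp hm (Equiv.swap (1 : Fin 3) 2)
    ((measurable_pi_apply 0).prodMk (measurable_pi_apply 1))
  have hfix : Equiv.swap (1 : Fin 3) 2 0 = 0 := by decide
  simpa [hfix] using h

end Exchangeability

section PastSigma

variable {Ω E F : Type*} [MeasurableSpace E] [MeasurableSpace F] {X : ℕ → Ω → E} {n : ℕ}

theorem pastSigma_le [MeasurableSpace Ω] (hm : ∀ n, Measurable (X n)) (n : ℕ) :
    pastSigma X n ≤ ‹MeasurableSpace Ω› :=
  (measurable_pi_lambda _ fun _ => hm _).comap_le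

theorem measurable_pastSigma {i : ℕ} (hi : i < n) : Measurable[pastSigma X n] (X i) :=
  (measurable_pi_apply (⟨i, hi⟩ : Fin n)).comp (comap_measurable fun ω (i : Fin n) => X i ω)

theorem pastSigma_comp_le {φ : E → F} (hφ : Measurable φ) (n : ℕ) :
    pastSigma (fun n ω => φ (X n ω)) n ≤ pastSigma X n :=
  (@measurable_pi_lambda _ _ _ (pastSigma X n) _ _ fun i : Fin n =>
    hφ.comp (measurable_pastSigma i.2)).comap_le

theorem stronglyMeasurable_predictive (R : Kernel E E) (n : ℕ) (c d : ℝ) {A : Set E}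
    (hA : MeasurableSet A) :
    StronglyMeasurable[pastSigma X n] fun ω =>
      (c + ∑ i ∈ Finset.range n, (R (X i ω)).real A) /
        (d + ∑ i ∈ Finset.range n, (R (X i ω)).real Set.univ) := by
  have hsum {S : Set E} (hS : MeasurableSet S) :
      Measurable[pastSigma X n] fun ω => ∑ i ∈ Finset.range n, (R (X i ω)).real S :=
    Finset.measurable_fun_sum _ fun i hi =>
      (R.measurable_coe hS).ennreal_toReal.comp (measurable_pastSigma (Finset.mem_range.1 hi))
  exact ((measurable_const.add (hsum hA)).div
    (measurable_const.add (hsum .univ))).stronglyMeasurable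

end PastSigma

theorem measure_eq_of_smul_eq_smul {E : Type*} [MeasurableSpace E] {μ₁ μ₂ : Measure E} {c : ENNReal}
    (hc₀ : c ≠ 0) (hc : c ≠ ⊤) (h : c • μ₁ = c • μ₂) : μ₁ = μ₂ := by
  ext A -
  exact (ENNReal.mul_right_inj hc₀ hc).1 (DFunLike.congr_fun h A)

section ParallelComp

variable {Ω E F G : Type*} [MeasurableSpace Ω] {mE : MeasurableSpace E} [MeasurableSpace F]
  {mG : MeasurableSpace G} {P : Measure Ω} {κ : Kernel E G}

theorem parallelComp_comp_map_prod_apply [IsSFiniteKernel κ] {Y : Ω → F} {Z : Ω → E}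
    (hY : Measurable Y) (hZ : Measurable Z) {B : Set F} {A : Set G} (hB : MeasurableSet B)
    (hA : MeasurableSet A) :
    (((Kernel.id : Kernel F F) ∥ₖ κ) ∘ₘ P.map (fun ω => (Y ω, Z ω))) (B ×ˢ A) =
      ∫⁻ ω in Y ⁻¹' B, κ (Z ω) A ∂P := by
  rw [Measure.bind_apply (hB.prod hA) (Kernel.id ∥ₖ κ).aemeasurable,
    lintegral_map (Kernel.measurable_coe _ (hB.prod hA)) (hY.prodMk hZ),
    ← lintegral_indicator (hY hB)]
  refine lintegral_congr fun ω => ?_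
  rw [Kernel.parallelComp_apply_prod, Kernel.id_apply, Measure.dirac_apply' _ hB]
  by_cases hω : Y ω ∈ B <;> simp [hω]

theorem parallelComp_comp_map_prod_self [SFinite P] {Z : Ω → E} (hZ : Measurable Z) :
    (Kernel.id ∥ₖ κ) ∘ₘ P.map (fun ω => (Z ω, Z ω)) = P.map Z ⊗ₘ κ := by
  rw [Measure.compProd_eq_parallelComp_comp_copy_comp, Kernel.copy,
    Measure.deterministic_comp_eq_map, Measure.map_map (by fun_prop) hZ]
  rfl

end ParallelComp

section JointLaws

variable {Ω E F : Type*} [MeasurableSpace Ω] {mE : MeasurableSpace E} [MeasurableSpace F]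
  {P : Measure Ω} {θ : ℝ} {ν : Measure E} {R κ : Kernel E E} {X : ℕ → Ω → E} {n : ℕ}

theorem Canonical.ae_univ_eq_one (hR : Canonical R) (hpos : StrictlyPositive ν R) :
    ∀ᵐ x ∂ν, R x Set.univ = 1 := by
  filter_upwards [measure_eq_zero_iff_ae_notMem.1 hpos] with x hx using hR x hx

theorem IsMVPS.condExp_of_ae_eq [IsMarkovKernel κ] (hX : IsMVPS P θ ν R X) (hR : R =ᵐ[ν] κ)
    (hlaw : ∀ i < n, P.map (X i) = ν) (hn : 1 ≤ n) {A : Set E} (hA : MeasurableSet A) :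
    P⟦X n ⁻¹' A | pastSigma X n⟧ =ᵐ[P] fun ω =>
      (θ * ν.real A + ∑ i ∈ Finset.range n, (κ (X i ω)).real A) / (θ + n) := by
  have hRX : ∀ᵐ ω ∂P, ∀ i ∈ Set.Iio n, R (X i ω) = κ (X i ω) :=
    (ae_ball_iff (Set.to_countable _)).2 fun i hi =>
      ae_of_ae_map (hX.measurable i).aemeasurable ((hlaw i hi).symm ▸ hR)
  filter_upwards [hX.predictive n hn A hA, hRX] with ω hω hRω
  have hsum (S : Set E) : ∑ i ∈ Finset.range n, (R (X i ω)).real S =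
      ∑ i ∈ Finset.range n, (κ (X i ω)).real S :=
    Finset.sum_congr rfl fun i hi => by rw [hRω i (Finset.mem_range.1 hi)]
  simp [hω, hsum]

theorem integrable_measureReal_comp [IsFiniteMeasure P] (κ : Kernel E F) [IsFiniteKernel κ]
    {Z : Ω → E} (hZ : Measurable Z) {A : Set F} (hA : MeasurableSet A) :
    Integrable (fun ω => (κ (Z ω)).real A) P :=
  .of_bound ((κ.measurable_coe hA).comp hZ).ennreal_toReal.aestronglyMeasurable κ.bound.toReal
    (ae_of_all _ fun ω => by
      rw [Real.norm_of_nonneg measureReal_nonneg]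
      exact ENNReal.toReal_mono κ.bound_ne_top (κ.measure_le_bound _ _))

theorem IsMVPS.mul_measureReal_inter [IsFiniteMeasure P] [IsMarkovKernel κ]
    (hX : IsMVPS P θ ν R X) (hR : R =ᵐ[ν] κ) (hlaw : ∀ i < n, P.map (X i) = ν) (hn : 1 ≤ n)
    {A : Set E} (hA : MeasurableSet A) {B : Set Ω} (hB : MeasurableSet[pastSigma X n] B) :
    (θ + n) * P.real (B ∩ X n ⁻¹' A) =
      θ * (P.real B * ν.real A) + ∑ i ∈ Finset.range n, ∫ ω in B, (κ (X i ω)).real A ∂P := by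
  have hle := pastSigma_le hX.measurable n
  have hθn : θ + n ≠ 0 := by have := hX.theta_pos; positivity
  have hXA : MeasurableSet (X n ⁻¹' A) := hX.measurable n hA
  have hint (i : ℕ) : IntegrableOn (fun ω => (κ (X i ω)).real A) B P :=
    (integrable_measureReal_comp κ (hX.measurable i) hA).integrableOn
  calc (θ + n) * P.real (B ∩ X n ⁻¹' A)
      = (θ + n) * ∫ ω in B, (P⟦X n ⁻¹' A | pastSigma X n⟧) ω ∂P := by
        rw [setIntegral_condExp hle ((integrable_const 1).indicator hXA) hB,
          setIntegral_indicator hXA]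
        simp
    _ = ∫ ω in B, (θ * ν.real A + ∑ i ∈ Finset.range n, (κ (X i ω)).real A) ∂P := by
        rw [integral_congr_ae (ae_restrict_of_ae (hX.condExp_of_ae_eq hR hlaw hn hA)),
          integral_div, mul_div_cancel₀ _ hθn]
    _ = θ * (P.real B * ν.real A) + ∑ i ∈ Finset.range n, ∫ ω in B, (κ (X i ω)).real A ∂P := by
        rw [integral_add (integrable_const _) (integrable_finsetSum _ fun i _ => hint i),
          integral_finsetSum _ fun i _ => hint i, setIntegral_const, smul_eq_mul]
        ring

theorem IsMVPS.mul_measure_inter [IsFiniteMeasure P] [IsMarkovKernel κ]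
    (hX : IsMVPS P θ ν R X) (hR : R =ᵐ[ν] κ) (hlaw : ∀ i < n, P.map (X i) = ν) (hn : 1 ≤ n)
    {A : Set E} (hA : MeasurableSet A) {B : Set Ω} (hB : MeasurableSet[pastSigma X n] B) :
    ENNReal.ofReal (θ + n) * P (B ∩ X n ⁻¹' A) =
      ENNReal.ofReal θ * (P B * ν A) + ∑ i ∈ Finset.range n, ∫⁻ ω in B, κ (X i ω) A ∂P := by
  have := hX.prob
  have hθ := hX.theta_pos
  have hfin (i : ℕ) : ∫⁻ ω in B, κ (X i ω) A ∂P ≠ ⊤ :=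
    ((lintegral_mono fun ω => prob_le_one (μ := κ (X i ω))).trans_lt (by simp)).ne
  have hreal (i : ℕ) : (∫⁻ ω in B, κ (X i ω) A ∂P).toReal = ∫ ω in B, (κ (X i ω)).real A ∂P :=
    (integral_toReal ((κ.measurable_coe hA).comp (hX.measurable i)).aemeasurable
      (ae_of_all _ fun ω => measure_lt_top _ _)).symm
  rw [← ENNReal.toReal_eq_toReal_iff' (by finiteness)
    (ENNReal.add_ne_top.2 ⟨by finiteness, ENNReal.sum_ne_top.2 fun i _ => hfin i⟩),
    ENNReal.toReal_add (by finiteness) (ENNReal.sum_ne_top.2 fun i _ => hfin i),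
    ENNReal.toReal_sum fun i _ => hfin i]
  simp only [ENNReal.toReal_mul, hreal, ENNReal.toReal_ofReal hθ.le,
    ENNReal.toReal_ofReal (show 0 ≤ θ + n by positivity)]
  exact hX.mul_measureReal_inter hR hlaw hn hA hB

theorem IsMVPS.smul_map_prod [IsFiniteMeasure P] [IsMarkovKernel κ]
    (hX : IsMVPS P θ ν R X) (hR : R =ᵐ[ν] κ) (hlaw : ∀ i < n, P.map (X i) = ν) (hn : 1 ≤ n)
    {Y : Ω → F} (hY : Measurable[pastSigma X n] Y) :
    ENNReal.ofReal (θ + n) • P.map (fun ω => (Y ω, X n ω)) =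
      ENNReal.ofReal θ • (P.map Y).prod ν +
        ∑ i ∈ Finset.range n, (Kernel.id ∥ₖ κ) ∘ₘ P.map (fun ω => (Y ω, X i ω)) := by
  have := hX.prob
  have hY' : Measurable Y := hY.mono (pastSigma_le hX.measurable n) le_rfl
  have := Measure.smul_finite (P.map fun ω => (Y ω, X n ω))
    (ENNReal.ofReal_ne_top (r := θ + n))
  refine Measure.ext_prod fun {B A} hB hA => ?_
  simp only [Measure.add_apply, Measure.smul_apply, Measure.finsetSum_apply, smul_eq_mul,
    Measure.prod_prod, Measure.map_apply hY' hB,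
    Measure.map_apply (hY'.prodMk (hX.measurable _)) (hB.prod hA),
    parallelComp_comp_map_prod_apply hY' (hX.measurable _) hB hA]
  exact hX.mul_measure_inter hR hlaw hn hA (hY hB)

theorem IsMVPS.smul_map [IsProbabilityMeasure P] [IsMarkovKernel κ]
    (hX : IsMVPS P θ ν R X) (hR : R =ᵐ[ν] κ) (hlaw : ∀ i < n, P.map (X i) = ν) (hn : 1 ≤ n) :
    ENNReal.ofReal (θ + n) • P.map (X n) = ENNReal.ofReal θ • ν + n • (κ ∘ₘ ν) := by
  ext A hA
  have h := hX.mul_measure_inter hR hlaw hn hA MeasurableSet.univ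
  have hκ : ∀ i ∈ Finset.range n, ∫⁻ ω, κ (X i ω) A ∂P = (κ ∘ₘ ν) A := fun i hi => by
    rw [← hlaw i (Finset.mem_range.1 hi), Measure.bind_apply hA κ.aemeasurable,
      lintegral_map (κ.measurable_coe hA) (hX.measurable i)]
  simp only [Set.univ_inter, measure_univ, one_mul, Measure.restrict_univ,
    Finset.sum_congr rfl hκ, Finset.sum_const, Finset.card_range] at h
  simpa [Measure.map_apply (hX.measurable n) hA] using h

theorem IsMVPS.invariant [IsProbabilityMeasure P] [IsMarkovKernel κ] (hX : IsMVPS P θ ν R X)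
    (hR : R =ᵐ[ν] κ) (hlaw : P.map (X 1) = ν) : Kernel.Invariant κ ν := by
  have := hX.prob
  have h := hX.smul_map (n := 1) hR (by simp [hX.law_zero]) le_rfl
  rw [hlaw, Nat.cast_one, ENNReal.ofReal_add hX.theta_pos.le zero_le_one, add_smul,
    ENNReal.ofReal_one, one_smul, one_smul] at h
  have := Measure.smul_finite ν (ENNReal.ofReal_ne_top (r := θ))
  exact ((Measure.add_right_inj _ _ _).1 h).symm

theorem IsMVPS.map_eq_of_invariant [IsProbabilityMeasure P] [IsMarkovKernel κ]
    (hX : IsMVPS P θ ν R X) (hR : R =ᵐ[ν] κ) (hκ : Kernel.Invariant κ ν) (n : ℕ) :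
    P.map (X n) = ν := by
  induction n using Nat.strong_induction_on with
  | _ n ih =>
    rcases n.eq_zero_or_pos with rfl | hn
    · exact hX.law_zero
    · have hθ := hX.theta_pos
      have h := hX.smul_map hR ih hn
      rw [hκ.def, ← Nat.cast_smul_eq_nsmul ENNReal, ← add_smul, ← ENNReal.ofReal_natCast,
        ← ENNReal.ofReal_add hθ.le n.cast_nonneg] at h
      have hpos : 0 < ENNReal.ofReal (θ + n) := ENNReal.ofReal_pos.2 (by positivity)
      exact measure_eq_of_smul_eq_smul hpos.ne' ENNReal.ofReal_ne_top h

theorem IsMVPS.smul_map_zero_one [IsFiniteMeasure P] [IsMarkovKernel κ]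
    (hX : IsMVPS P θ ν R X) (hR : R =ᵐ[ν] κ) :
    ENNReal.ofReal (θ + 1) • P.map (fun ω => (X 0 ω, X 1 ω)) =
      ENNReal.ofReal θ • ν.prod ν + ν ⊗ₘ κ := by
  have h := hX.smul_map_prod (n := 1) hR (by simp [hX.law_zero]) le_rfl
    (measurable_pastSigma zero_lt_one)
  rwa [Finset.sum_range_one, parallelComp_comp_map_prod_self (hX.measurable 0), hX.law_zero,
    Nat.cast_one] at h

theorem IsMVPS.map_zero_one_eq_parallelComp [IsFiniteMeasure P] [IsMarkovKernel κ]
    (hX : IsMVPS P θ ν R X) (hR : R =ᵐ[ν] κ) (hlaw : P.map (X 1) = ν)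
    (hpair : P.map (fun ω => (X 0 ω, X 2 ω)) = P.map (fun ω => (X 0 ω, X 1 ω))) :
    P.map (fun ω => (X 0 ω, X 1 ω)) =
      (Kernel.id ∥ₖ κ) ∘ₘ P.map (fun ω => (X 0 ω, X 1 ω)) := by
  have hlaws : ∀ i < 2, P.map (X i) = ν := fun i hi => by
    interval_cases i
    exacts [hX.law_zero, hlaw]
  have hθ : ENNReal.ofReal (θ + (2 : ℕ)) = ENNReal.ofReal (θ + 1) + 1 := by
    rw [← ENNReal.ofReal_one, ← ENNReal.ofReal_add (by linarith [hX.theta_pos]) zero_le_one]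
    norm_num [add_assoc]
  have h := hX.smul_map_prod (n := 2) hR hlaws one_le_two (measurable_pastSigma zero_lt_two)
  rw [hθ, hpair, Finset.sum_range_succ, Finset.sum_range_one,
    parallelComp_comp_map_prod_self (hX.measurable 0), hX.law_zero, ← add_assoc,
    ← hX.smul_map_zero_one hR, add_smul, one_smul] at h
  have := Measure.smul_finite (P.map fun ω => (X 0 ω, X 1 ω)) (ENNReal.ofReal_ne_top (r := θ + 1))
  exact (Measure.add_right_inj _ _ _).1 h

theorem IsMVPS.idempotent [MeasurableSpace.CountablyGenerated E] [IsProbabilityMeasure P]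
    [IsMarkovKernel κ] (hX : IsMVPS P θ ν R X) (hR : R =ᵐ[ν] κ) (hlaw : P.map (X 1) = ν)
    (hpair : P.map (fun ω => (X 0 ω, X 2 ω)) = P.map (fun ω => (X 0 ω, X 1 ω))) :
    κ ∘ₖ κ =ᵐ[ν] κ := by
  have := hX.prob
  have h : ENNReal.ofReal θ • ν.prod ν + ν ⊗ₘ κ =
      ENNReal.ofReal θ • ν.prod ν + ν ⊗ₘ (κ ∘ₖ κ) := by
    calc ENNReal.ofReal θ • ν.prod ν + ν ⊗ₘ κ
        = (Kernel.id ∥ₖ κ) ∘ₘ (ENNReal.ofReal θ • ν.prod ν + ν ⊗ₘ κ) := by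
          rw [← hX.smul_map_zero_one hR, Measure.comp_smul,
            ← hX.map_zero_one_eq_parallelComp hR hlaw hpair]
      _ = ENNReal.ofReal θ • ν.prod ν + ν ⊗ₘ (κ ∘ₖ κ) := by
          rw [Measure.comp_add, Measure.comp_smul, ← Measure.prod_comp_right,
            (hX.invariant hR hlaw).def, Measure.parallelComp_comp_compProd]
  have := Measure.smul_finite (ν.prod ν) (ENNReal.ofReal_ne_top (r := θ))
  exact (Kernel.ae_eq_of_compProd_eq ((Measure.add_right_inj _ _ _).1 h)).symm

end JointLaws

theorem condExp_ae_eq_of_le {Ω : Type*} {m₁ m₂ m : MeasurableSpace Ω} {P : Measure Ω}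
    [IsFiniteMeasure P] {f g : Ω → ℝ} (h₁₂ : m₁ ≤ m₂) (h₂ : m₂ ≤ m) (hg : StronglyMeasurable[m₁] g)
    (hfg : P[f | m₂] =ᵐ[P] g) : P[f | m₁] =ᵐ[P] g :=
  calc P[f | m₁] =ᵐ[P] P[P[f | m₂] | m₁] := (condExp_condExp_of_le h₁₂ h₂).symm
    _ =ᵐ[P] P[g | m₁] := condExp_congr_ae hfg
    _ = g := condExp_of_stronglyMeasurable (h₁₂.trans h₂) hg (integrable_condExp.congr hfg)

section Image

variable {Ω E F : Type*} [MeasurableSpace Ω] {mE : MeasurableSpace E} [MeasurableSpace F]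
  {P : Measure Ω} {θ : ℝ} {ν : Measure E} {R : Kernel E E} {X : ℕ → Ω → E}

theorem IsMVPS.comp [IsFiniteMeasure P] (hX : IsMVPS P θ ν R X) (hlaw : ∀ n, P.map (X n) ≪ ν)
    {φ : E → F} (hφ : Measurable φ) {R' : Kernel F F} (hR' : ∀ y, IsFiniteMeasure (R' y))
    (hRR' : ∀ S, MeasurableSet S → ∀ᵐ x ∂ν, R x (φ ⁻¹' S) = R' (φ x) S) :
    IsMVPS P θ (ν.map φ) R' (fun n ω => φ (X n ω)) where
  theta_pos := hX.theta_pos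
  prob := have := hX.prob; Measure.isProbabilityMeasure_map hφ.aemeasurable
  finite := hR'
  measurable n := hφ.comp (hX.measurable n)
  law_zero := by
    rw [← hX.law_zero, Measure.map_map hφ (hX.measurable 0)]
    rfl
  predictive n hn S hS := by
    refine condExp_ae_eq_of_le (pastSigma_comp_le hφ n) (pastSigma_le hX.measurable n)
      (stronglyMeasurable_predictive R' n _ _ hS) ?_
    have hRX {S : Set F} (hS : MeasurableSet S) :
        ∀ᵐ ω ∂P, ∀ i, R (X i ω) (φ ⁻¹' S) = R' (φ (X i ω)) S :=
      ae_all_iff.2 fun i => ae_of_ae_map (hX.measurable i).aemeasurable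
        ((hlaw i).ae_le (hRR' S hS))
    filter_upwards [hX.predictive n hn _ (hφ hS), hRX hS, hRX .univ] with ω hω hωS hωuniv
    rw [Set.preimage_univ] at hωuniv
    simp only [measureReal_def, Measure.map_apply hφ hS, ← hωS, ← hωuniv]
    exact hω

theorem condExpKernel_ae_eq_indicator {E : Type*} {m mE : MeasurableSpace E}
    [StandardBorelSpace E] {ν : Measure E} [IsFiniteMeasure ν] (hm : m ≤ mE) {B : Set E}
    (hB : MeasurableSet[m] B) : ∀ᵐ x ∂ν, condExpKernel ν m x B = B.indicator 1 x := by
  have hcond := condExpKernel_ae_eq_condExp (μ := ν) hm (hm B hB)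
  rw [condExp_of_stronglyMeasurable hm (stronglyMeasurable_const.indicator hB)
    ((integrable_const (1 : ℝ)).indicator (hm B hB))] at hcond
  filter_upwards [hcond] with x hx
  rw [← ENNReal.toReal_eq_toReal_iff' (by finiteness) (by by_cases h : x ∈ B <;> simp [h]),
    ← measureReal_def, hx]
  by_cases h : x ∈ B <;> simp [h]

theorem IsMVPS.isPolyaSequence_atomMap {E : Type*} {𝒢 mE : MeasurableSpace E}
    [StandardBorelSpace E] [IsFiniteMeasure P] {ν : Measure E} [IsFiniteMeasure ν]
    {R : Kernel E E} {X : ℕ → Ω → E} (hX : IsMVPS P θ ν R X) (hlaw : ∀ n, P.map (X n) ≪ ν)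
    (h𝒢 : 𝒢 ≤ mE) (hR : ∀ᵐ x ∂ν, R x = condExpKernel ν 𝒢 x) :
    IsPolyaSequence P θ (atomMeasure ν 𝒢) (fun n ω => atomMap 𝒢 (X n ω)) := by
  refine hX.comp hlaw (measurable_atomMap h𝒢) (fun y => ?_) fun S hS => ?_
  · rw [Kernel.id_apply]
    infer_instance
  · filter_upwards [hR, condExpKernel_ae_eq_indicator h𝒢 hS] with x hx hxS
    rw [hx, hxS, Kernel.id_apply, Measure.dirac_apply' _ hS]
    rfl

end Image

end MVPS

theorem mainTheorem9_general {Ω 𝕏 : Type*} [MeasurableSpace Ω] [m𝕏 : MeasurableSpace 𝕏]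
    [StandardBorelSpace 𝕏] (P : Measure Ω) [IsProbabilityMeasure P] (θ : ℝ) (ν : Measure 𝕏)
    [IsProbabilityMeasure ν] (R : Kernel 𝕏 𝕏) (X : ℕ → Ω → 𝕏) (hX : MVPS.IsMVPS P θ ν R X)
    (hlaw : P.map (X 1) = ν)
    (hpair : P.map (fun ω => (X 0 ω, X 2 ω)) = P.map (fun ω => (X 0 ω, X 1 ω)))
    (hR : ∀ᵐ x ∂ν, R x Set.univ = 1) :
    (∃ 𝒢 : MeasurableSpace 𝕏, MVPS.IsConditioning ν R 𝒢) ∧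
    ∀ 𝒢 : MeasurableSpace 𝕏, 𝒢 ≤ m𝕏 →
      (∀ᵐ x ∂ν, (R x Set.univ)⁻¹ • R x = condExpKernel (mΩ := m𝕏) ν 𝒢 x) →
      MVPS.IsPolyaSequence P θ (MVPS.atomMeasure ν 𝒢) (fun n ω => MVPS.atomMap 𝒢 (X n ω)) := by
  obtain ⟨κ, hRκ, _⟩ := Kernel.exists_ae_eq_isMarkovKernel (hR.mono fun _ hx => ⟨hx⟩)
    (IsProbabilityMeasure.ne_zero ν)
  have hinv : Kernel.Invariant κ ν := hX.invariant hRκ hlaw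
  have hidem : κ ∘ₖ κ =ᵐ[ν] κ := hX.idempotent hRκ hlaw hpair
  have hac : ∀ n, P.map (X n) ≪ ν := fun n =>
    (hX.map_eq_of_invariant hRκ hinv n).le.absolutelyContinuous
  refine ⟨⟨MVPS.kernelSigma κ, MVPS.isConditioning_kernelSigma hinv hidem hRκ⟩,
    fun 𝒢 h𝒢 hR𝒢 => ?_⟩
  refine hX.isPolyaSequence_atomMap hac h𝒢 ?_
  filter_upwards [hR, hR𝒢] with x hx hx𝒢
  rwa [hx, inv_one, one_smul] at hx𝒢

theorem mainTheorem9 {Ω 𝕏 : Type*} [MeasurableSpace Ω] [MeasurableSpace 𝕏] [StandardBorelSpace 𝕏]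
    (P : Measure Ω) [IsProbabilityMeasure P] (θ : ℝ) (ν : Measure 𝕏) [IsProbabilityMeasure ν]
    (R : Kernel 𝕏 𝕏) (X : ℕ → Ω → 𝕏)
    (hX : MVPS.IsMVPS P θ ν R X) (hexch : MVPS.Exchangeable P X)
    (hcan : MVPS.Canonical R) (hpos : MVPS.StrictlyPositive ν R) :
    (∃ 𝒢 : MeasurableSpace 𝕏, MVPS.IsConditioning ν R 𝒢) ∧
    ∀ 𝒢 : MeasurableSpace 𝕏, MVPS.IsConditioning ν R 𝒢 →
      MVPS.IsPolyaSequence P θ (MVPS.atomMeasure ν 𝒢) (fun n ω => MVPS.atomMap 𝒢 (X n ω)) := by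
  obtain ⟨hexists, hpolya⟩ := mainTheorem9_general P θ ν R X hX
    ((hexch.map_one hX.measurable).trans hX.law_zero) (hexch.map_zero_two hX.measurable)
    (hcan.ae_univ_eq_one hpos)
  exact ⟨hexists, fun 𝒢 h => hpolya 𝒢 h.le h.ae_eq⟩
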